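/- Let $K$ be an algebraically closed field, let $r\ge 1$ and $c_1,\dots,c_r\ge 1$ be integers. Let $A=(B_1\|B_2\|\cdots\|B_r)$ be a barred matrix, i.e. for $i=1,\dots,r$ $$B_i=\begin{pmatrix}X^i_1&X^i_2&\cdots&X^i_{c_i}\\ X^i_2&X^i_3&\cdots&X^i_{c_i+1}\end{pmatrix},$$ where the $X^i_j$ are indeterminates over $K$ and $X^i_j\neq X^h_k$ for $(i,j)\ne(h,k)$, with one only possible exception: for every $i<r$ there may be at most one index $i'>i$ such that $X^i_{c_i+1}=X^{i'}_1$. Let $R=K[\{X^i_j\}]$ be the polynomial ring in all these indeterminates, and let $J\subset R$ be the ideal generated by the minors $X^i_jX^i_{j'+1}-X^i_{j'}X^i_{j+1}$ ($1\le i\le r$, $1\le j<j'\le c_i$) together with the products $X^i_jX^{i'}_{j'}$ with $1\le i<i'\le r$, $1\le j\le c_i$, $2\le j'\le c_{i'}+1$. Put $$F^i_j=\sum_{k=0}^{j}(-1)^k\binom{j}{k}(X^i_{j+2})^{j-k}X^i_{k+1}(X^i_{j+1})^k\quad(1\le i\le r,\ 1\le j\le c_i-1),$$ $$G_k=\sum_{i=1}^{r-k}X^i_1X^{i+k}_{c_{i+k}+1}\quad(1\le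 k\le r-1).$$ Then $J$ is a proper radical ideal of pure height $\sum_{i=1}^r c_i-1$ (every minimal prime of $J$ has this height). Moreover, $J$ is a set-theoretic complete intersection on the $\sum_{i=1}^r c_i-1$ polynomials $F^i_j$, $G_k$: $J$ is the radical of the ideal they generate, their number is equal to the height of $J$, and $J$ is not the radical of an ideal generated by fewer elements. -/

import Mathlib

open MvPolynomial

/-- A family `F` of polynomials (indexed by a finite type) exhibits the ideal `I` as a set-theoretic
complete intersection: `I` is the radical of the ideal generated by the family, the number of members
of the family is the least possible number of elements with this property, and it is equal to the
height of `I`. -/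
def IsSetTheoreticCompleteIntersectionOn {R : Type*} [CommRing R] (I : Ideal R)
    {ι : Type*} [Fintype ι] (F : ι → R) : Prop :=
  I = (Ideal.span (Set.range F)).radical ∧
  (∀ (t : ℕ) (H : Fin t → R), I = (Ideal.span (Set.range H)).radical → Fintype.card ι ≤ t) ∧
  I.height = (Fintype.card ι : ℕ∞)

/-- The proper ideal `I` has pure height `h`: all its minimal primes have height `h`. -/
def IsOfPureHeight {R : Type*} [CommRing R] (I : Ideal R) (h : ℕ) : Prop :=
  I ≠ ⊤ ∧ ∀ P ∈ I.minimalPrimes, P.height = (h : ℕ∞)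

/-- The pattern of indeterminates of a barred matrix `(B₁ ‖ ⋯ ‖ B_r)`, where `B_i` is a scroll matrix
with `c i` columns built on the indeterminates `X^i_1, …, X^i_{c_i+1}`. The set of all indeterminates
is indexed by `σ`, and `entry i j` is the index in `σ` of the indeterminate `X^{i+1}_{j+1}` (blocks
and entries are counted from `0` here). -/
structure BarredMatrix {r : ℕ} (c : Fin r → ℕ) (σ : Type*) where
  /-- the entries of the blocks -/
  entry : (i : Fin r) → Fin (c i + 1) → σ
  /-- every indeterminate occurs in the matrix -/
  entry_surjective : ∀ s : σ, ∃ (i : Fin r) (j : Fin (c i + 1)), entry i j = s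
  /-- entries at different places are different, except that the last entry of a block may be the
  first entry of a later block -/
  eq_entry_imp : ∀ p q : (Σ i : Fin r, Fin (c i + 1)), p ≠ q →
    entry p.1 p.2 = entry q.1 q.2 →
      (p.1 < q.1 ∧ p.2 = Fin.last (c p.1) ∧ q.2 = 0) ∨
      (q.1 < p.1 ∧ q.2 = Fin.last (c q.1) ∧ p.2 = 0)
  /-- the last entry of a block is the first entry of at most one later block -/
  last_entry_unique : ∀ i i' i'' : Fin r, i < i' → i < i'' →
    entry i (Fin.last (c i)) = entry i' 0 → entry i (Fin.last (c i)) = entry i'' 0 → i' = i''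

namespace BarredMatrix

variable {r : ℕ} {c : Fin r → ℕ} {σ : Type*} (A : BarredMatrix c σ) (K : Type*) [Field K]

/-- The block `B_i`: the upper row is `X^i_1, …, X^i_{c_i}`, the lower row
`X^i_2, …, X^i_{c_i+1}`. -/
noncomputable def block (i : Fin r) : Matrix (Fin 2) (Fin (c i)) (MvPolynomial σ K) :=
  Matrix.of ![fun j => X (A.entry i j.castSucc), fun j => X (A.entry i j.succ)]

/-- The minor of `B_i` formed by its columns `j` and `j'`. -/
noncomputable def minor (i : Fin r) (j j' : Fin (c i)) : MvPolynomial σ K :=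
  ((A.block K i).submatrix id ![j, j']).det

/-- The ideal `J`, generated by the minors of the blocks and the products of an entry of the upper
row of a block with an entry of the lower row of a later block. -/
noncomputable def ideal : Ideal (MvPolynomial σ K) :=
  Ideal.span
    ({f | ∃ (i : Fin r) (j j' : Fin (c i)), j < j' ∧ f = A.minor K i j j'} ∪
     {f | ∃ (i i' : Fin r) (j : Fin (c i)) (j' : Fin (c i')), i < i' ∧
        f = A.block K i 0 j * A.block K i' 1 j'})

/-- The Bardelli–Verdi polynomials of the block `B_i`. With `m = j + 1`, which runs through
`1, …, c_i - 1`, this is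
`∑_{k=0}^{m} (-1)^k (m choose k) (X^i_{m+2})^{m-k} X^i_{k+1} (X^i_{m+1})^k`. -/
noncomputable def F (i : Fin r) (j : Fin (c i - 1)) : MvPolynomial σ K :=
  ∑ k : Fin (j.val + 2),
    (-1) ^ k.val * ((j.val + 1).choose k.val : MvPolynomial σ K) *
      X (A.entry i ⟨j.val + 2, by omega⟩) ^ (j.val + 1 - k.val) *
      X (A.entry i ⟨k.val, by omega⟩) *
      X (A.entry i ⟨j.val + 1, by omega⟩) ^ k.val

/-- With `m = k + 1`, which runs through `1, …, r - 1`, this is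
`∑_{i=1}^{r-m} X^i_1 X^{i+m}_{c_{i+m}+1}`. -/
noncomputable def G (k : Fin (r - 1)) : MvPolynomial σ K :=
  ∑ i : Fin (r - (k.val + 1)),
    X (A.entry ⟨i.val, by omega⟩ 0) * X (A.entry ⟨i.val + (k.val + 1), by omega⟩ (Fin.last _))

/-- The family of all the polynomials `F^i_j` and `G_k`. -/
noncomputable def equations :
    (Σ i : Fin r, Fin (c i - 1)) ⊕ Fin (r - 1) → MvPolynomial σ K :=
  Sum.elim (fun p => A.F K p.1 p.2) (A.G K)

end BarredMatrix

/-! The ideal J is the intersection of the primes ker(`param t`), one for each block B_t. The map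
`param t` kills the upper rows of the blocks before B_t and the lower rows of those after it, and
sends the entries of B_t to a, al, al², …. Hence J is radical and its minimal primes are among these
kernels (`ideal_eq_iInf`, `exists_eq_ker_param`). The hard inclusion is combinatorial: J contains
every monomial killed by all the maps, and every difference of monomials identified by one of them.

For the equations, let a prime P contain all F and G and work in the fraction field of R/P. By the
binomial theorem, the vanishing of the F makes each block a geometric progression with nonzero
initial term, unless its upper row vanishes (`eq_zero_or_geometric`). The vanishing of the G makes
each product of a first entry and a later last entry vanish (`mul_eq_zero_of_diagonal_sums`).
Together these facts force every generator of J into P.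

The number of equations is Σ(c_i − 1) + (r − 1), so Krull's theorem bounds the heights of the
minimal primes from above. An explicit chain of primes below ker(`param t`) gives the same bound
from below (`le_height_ker_param`). Krull's theorem also excludes a smaller system of equations. -/

/-! ### Monomials on the rational normal curve and zeros of the Bardelli–Verdi polynomials -/

section RationalNormalCurve

variable {S : Type*} [CommRing S]

/-- The common value of all monomials of degree `d` and weight `w` in elements `y 0, …, y n`
satisfying the equations of the rational normal curve. -/
def scrollMonomial (n : ℕ) (y : ℕ → S) : ℕ → ℕ → S
  | 0, _ => 1
  | d + 1, w => if n ≤ w then y n * scrollMonomial n y d (w - n) else y w * y 0 ^ d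

theorem mul_shift_eq {n : ℕ} {y : ℕ → S}
    (hy : ∀ p q, p < n → q < n → y p * y (q + 1) = y (p + 1) * y q) (k : ℕ) :
    ∀ p q, p + k ≤ n → q + k ≤ n → y p * y (q + k) = y (p + k) * y q := by
  induction k with
  | zero => intro p q _ _; rfl
  | succ k ih =>
    intro p q hp hq
    have h1 := hy p (q + k) (by omega) (by omega)
    have h2 := ih (p + 1) q (by omega) (by omega)
    rw [show q + (k + 1) = q + k + 1 by ring, h1, h2, show p + 1 + k = p + (k + 1) by ring]

theorem scrollMonomial_zero_right {n : ℕ} {y : ℕ → S} (hn : 0 < n) (d : ℕ) :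
    scrollMonomial n y d 0 = y 0 ^ d := by
  cases d with
  | zero => simp [scrollMonomial]
  | succ d => rw [scrollMonomial, if_neg (by omega), pow_succ']

/-- If w ≥ n, a factor `y n` splits off and induction applies. Otherwise only the product `y p * y
w` needs rewriting: as `y n * y (p + w - n)` or as `y (p + w) * y 0`, according to whether p + w
reaches n. -/
theorem mul_scrollMonomial {n : ℕ} {y : ℕ → S} (hn : 0 < n)
    (hy : ∀ p q, p < n → q < n → y p * y (q + 1) = y (p + 1) * y q)
    {p : ℕ} (hp : p ≤ n) (d : ℕ) :
    ∀ w, w ≤ d * n → y p * scrollMonomial n y d w = scrollMonomial n y (d + 1) (p + w) := by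
  induction d with
  | zero =>
    intro w hw
    obtain rfl : w = 0 := by simpa using hw
    by_cases h : n ≤ p
    · obtain rfl : p = n := le_antisymm hp h
      simp [scrollMonomial]
    · simp [scrollMonomial, h]
  | succ d ih =>
    intro w hw
    by_cases h : n ≤ w
    · rw [scrollMonomial, if_pos h, mul_left_comm, ih (w - n) (by rw [Nat.succ_mul] at hw; omega),
        scrollMonomial.eq_def n y (d + 1 + 1)]
      simp only
      rw [if_pos (by omega), Nat.add_sub_assoc h]
    · rw [scrollMonomial, if_neg h, scrollMonomial]
      by_cases h' : n ≤ p + w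
      · rw [if_pos h', ← mul_assoc]
        have := mul_shift_eq hy (n - p) p (p + w - n) (by omega) (by omega)
        rw [show p + w - n + (n - p) = w by omega, show p + (n - p) = n by omega] at this
        rw [this, mul_assoc]
        by_cases hpw : p + w - n = 0
        · rw [hpw, scrollMonomial_zero_right hn, pow_succ']
        · rw [scrollMonomial, if_neg (by omega)]
      · have := mul_shift_eq hy w p 0 (by omega) (by omega)
        rw [zero_add] at this
        rw [if_neg h', ← mul_assoc, this, pow_succ', mul_assoc]

theorem pow_mul_scrollMonomial {n : ℕ} {y : ℕ → S} (hn : 0 < n)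
    (hy : ∀ p q, p < n → q < n → y p * y (q + 1) = y (p + 1) * y q)
    {p : ℕ} (hp : p ≤ n) {d w : ℕ} (hw : w ≤ d * n) (a : ℕ) :
    y p ^ a * scrollMonomial n y d w = scrollMonomial n y (a + d) (a * p + w) := by
  induction a with
  | zero => simp
  | succ a ih =>
    rw [pow_succ', mul_assoc, ih, mul_scrollMonomial hn hy hp]
    · congr 1 <;> ring
    · rw [add_mul]; exact add_le_add (Nat.mul_le_mul_left _ hp) hw

theorem prod_pow_eq_scrollMonomial {n : ℕ} {y : ℕ → S} (hn : 0 < n)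
    (hy : ∀ p q, p < n → q < n → y p * y (q + 1) = y (p + 1) * y q)
    (e : Fin (n + 1) → ℕ) :
    ∏ k : Fin (n + 1), y k ^ e k = scrollMonomial n y (∑ k, e k) (∑ k, e k * k) := by
  classical
  refine Finset.induction_on (Finset.univ : Finset (Fin (n + 1))) (by simp [scrollMonomial]) ?_
  intro k s hk ih
  rw [Finset.prod_insert hk, Finset.sum_insert hk, Finset.sum_insert hk, ih,
    pow_mul_scrollMonomial hn hy (Nat.lt_succ_iff.mp k.2)]
  rw [Finset.sum_mul]
  exact Finset.sum_le_sum fun i _ => Nat.mul_le_mul_left _ (Nat.lt_succ_iff.mp i.2)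

/-- Monomials of the same degree and weight agree on the rational normal curve. -/
theorem prod_pow_eq_prod_pow {n : ℕ} (hn : 0 < n) {x : Fin (n + 1) → S}
    (hx : ∀ p q : Fin n, x p.castSucc * x q.succ = x p.succ * x q.castSucc)
    {e e' : Fin (n + 1) → ℕ} (h : ∑ k, e k = ∑ k, e' k)
    (h' : ∑ k, e k * (k : ℕ) = ∑ k, e' k * (k : ℕ)) :
    ∏ k, x k ^ e k = ∏ k, x k ^ e' k := by
  let y : ℕ → S := fun k => if hk : k < n + 1 then x ⟨k, hk⟩ else 0
  have hxy : ∀ k : Fin (n + 1), x k = y k := fun k => by simp only [y]; rw [dif_pos k.2]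
  have hy : ∀ p q, p < n → q < n → y p * y (q + 1) = y (p + 1) * y q := by
    intro p q hp hq
    have := hx ⟨p, hp⟩ ⟨q, hq⟩
    rwa [hxy, hxy, hxy, hxy] at this
  simp only [hxy]
  rw [prod_pow_eq_scrollMonomial hn hy, prod_pow_eq_scrollMonomial hn hy, h, h']

/-- The Bardelli–Verdi polynomial of order `m + 1` in elements `y 0, …, y (m + 2)`. -/
def bardelliVerdi (y : ℕ → S) (m : ℕ) : S :=
  ∑ k ∈ Finset.range (m + 2), (-1) ^ k * ((m + 1).choose k : S) * y (m + 2) ^ (m + 1 - k) *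
    y k * y (m + 1) ^ k

/-- The sum is the binomial expansion of the power. If it vanishes and a ≠ 0 in a field, the
progression extends by one term. -/
theorem bardelliVerdi_of_geometric {y : ℕ → S} {m : ℕ} {a l : S}
    (h : ∀ k ≤ m + 1, y k = a * l ^ k) :
    bardelliVerdi y m = a * (y (m + 2) - l * y (m + 1)) ^ (m + 1) := by
  rw [sub_eq_add_neg, add_comm, add_pow, Finset.mul_sum]
  refine Finset.sum_congr rfl fun k hk => ?_
  rw [h k (by simp at hk; omega), ← neg_one_mul (l * _), mul_pow, mul_pow]
  ring

theorem bardelliVerdi_of_zero {y : ℕ → S} {m : ℕ} (h : ∀ k ≤ m, y k = 0) :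
    bardelliVerdi y m = (-1) ^ (m + 1) * y (m + 1) ^ (m + 2) := by
  rw [bardelliVerdi, Finset.sum_range_succ, Finset.sum_eq_zero]
  · simp; ring
  · intro k hk
    rw [h k (by simp at hk; omega)]; ring

end RationalNormalCurve

/-- A zero of the Bardelli–Verdi polynomials in a field is either a geometric progression, or its
terms vanish except for the last. -/
theorem eq_zero_or_geometric {L : Type*} [Field L] {y : ℕ → L} (n : ℕ)
    (h : ∀ m, m < n → bardelliVerdi y m = 0) :
    (∀ k ≤ n, y k = 0) ∨ ∃ a l, a ≠ 0 ∧ ∀ k ≤ n + 1, y k = a * l ^ k := by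
  induction n with
  | zero =>
    by_cases h0 : y 0 = 0
    · left; intro k hk; rw [Nat.le_zero.mp hk, h0]
    · right
      refine ⟨y 0, y 1 / y 0, h0, fun k hk => ?_⟩
      interval_cases k
      · simp
      · field_simp
  | succ n ih =>
    have hn := h n (by omega)
    rcases ih fun m hm => h m (by omega) with h0 | ⟨a, l, ha, hl⟩
    · left
      rw [bardelliVerdi_of_zero h0] at hn
      have h1 : y (n + 1) = 0 := by simpa using hn
      intro k hk
      rcases Nat.le_succ_iff.mp hk with h | rfl
      exacts [h0 k h, h1]
    · right
      rw [bardelliVerdi_of_geometric hl] at hn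
      have h1 : y (n + 2) - l * y (n + 1) = 0 := by simpa [ha] using hn
      refine ⟨a, l, ha, fun k hk => ?_⟩
      rcases Nat.le_succ_iff.mp hk with h | rfl
      · exact hl k h
      · rw [Nat.succ_eq_add_one, sub_eq_zero.mp h1, hl _ le_rfl]; ring

/-! ### Intersections of kernels of monomial substitutions -/

section MonomialSubst

variable {σ τ : Type*} (K : Type*) [Field K]

/-- The substitution which kills the variables in `s` and replaces any other variable `X i` by the
monomial with exponent `v i`. -/
noncomputable def monomialSubst (s : Set σ) (v : σ → τ →₀ ℕ) :
    MvPolynomial σ K →ₐ[K] MvPolynomial τ K :=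
  open Classical in aeval fun i => if i ∈ s then 0 else monomial (v i) 1

variable {K}

theorem monomialSubst_X_of_mem {s : Set σ} {v : σ → τ →₀ ℕ} {i : σ} (hi : i ∈ s) :
    monomialSubst K s v (X i) = 0 := by
  simp [monomialSubst, hi]

theorem monomialSubst_X_of_notMem {s : Set σ} {v : σ → τ →₀ ℕ} {i : σ} (hi : i ∉ s) :
    monomialSubst K s v (X i) = monomial (v i) 1 := by
  simp [monomialSubst, hi]

theorem monomialSubst_monomial_of_mem {s : Set σ} {v : σ → τ →₀ ℕ} {m : σ →₀ ℕ} {i : σ}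
    (hm : i ∈ m.support) (hi : i ∈ s) (a : K) : monomialSubst K s v (monomial m a) = 0 := by
  rw [monomialSubst, aeval_monomial, Finsupp.prod, Finset.prod_eq_zero hm, mul_zero]
  rw [if_pos hi, zero_pow (Finsupp.mem_support_iff.mp hm)]

theorem monomialSubst_monomial {s : Set σ} {v : σ → τ →₀ ℕ} {m : σ →₀ ℕ}
    (hm : ∀ i ∈ m.support, i ∉ s) (a : K) :
    monomialSubst K s v (monomial m a) = monomial (Finsupp.linearCombination ℕ v m) a := by
  rw [monomialSubst, aeval_monomial, Finsupp.prod, Finsupp.linearCombination_apply, Finsupp.sum,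
    Finset.prod_congr rfl (g := fun i => monomial (m i • v i) (1 : K))]
  · rw [← monomial_sum_one, algebraMap_eq, C_mul_monomial, mul_one]
  · intro i hi
    rw [if_neg (hm i hi), monomial_pow, one_pow]

/-- An ideal contains the intersection of the kernels of a family of monomial substitutions if it
contains all monomials killed by all of them, and all differences of monomials identified by one
of them. -/
theorem iInf_ker_monomialSubst_le {ι : Type*} {s : ι → Set σ} {v : ι → σ → τ →₀ ℕ}
    {J : Ideal (MvPolynomial σ K)} (hJ : ∀ t, J ≤ RingHom.ker (monomialSubst K (s t) (v t)))
    (h0 : ∀ m : σ →₀ ℕ, (∀ t, ∃ i ∈ m.support, i ∈ s t) → monomial m (1 : K) ∈ J)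
    (h1 : ∀ t, ∀ m m' : σ →₀ ℕ, (∀ i ∈ m.support, i ∉ s t) → (∀ i ∈ m'.support, i ∉ s t) →
      Finsupp.linearCombination ℕ (v t) m = Finsupp.linearCombination ℕ (v t) m' →
      monomial m (1 : K) - monomial m' 1 ∈ J) :
    ⨅ t, RingHom.ker (monomialSubst K (s t) (v t)) ≤ J := by
  classical
  have smul_mem : ∀ (a : K) {p : MvPolynomial σ K}, p ∈ J → a • p ∈ J := fun a p hp => by
    rw [smul_eq_C_mul]; exact J.mul_mem_left _ hp
  suffices ∀ N, ∀ f : MvPolynomial σ K, f.support.card = N →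
      f ∈ ⨅ t, RingHom.ker (monomialSubst K (s t) (v t)) → f ∈ J from fun f hf => this _ f rfl hf
  intro N
  induction N using Nat.strong_induction_on with
  | _ N ih =>
  intro f hN hf
  by_cases hf0 : f = 0
  · rw [hf0]; exact J.zero_mem
  obtain ⟨m, hm⟩ := Finset.nonempty_iff_ne_empty.mpr (mt support_eq_empty.mp hf0)
  -- Induction on the number of terms: subtracting g removes the monomial m and creates no new one.
  suffices ∃ g ∈ J, (f - g).support ⊆ f.support.erase m by
    obtain ⟨g, hg, hsupp⟩ := this
    have hlt : (f - g).support.card < N := hN ▸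
      (Finset.card_le_card hsupp).trans_lt (Finset.card_erase_lt_of_mem hm)
    have := ih _ hlt (f - g) rfl
      (Ideal.sub_mem _ hf ((le_iInf hJ : J ≤ _) hg))
    simpa using J.add_mem this hg
  have key : ∀ g : MvPolynomial σ K, coeff m g = coeff m f → g.support ⊆ f.support →
      (f - g).support ⊆ f.support.erase m := by
    intro g hgm hg m' hm'
    rw [Finset.mem_erase]
    refine ⟨?_, ?_⟩
    · rintro rfl
      simp [hgm] at hm'
    · rcases Finset.mem_union.mp (support_sub σ f g hm') with h | h
      exacts [h, hg h]
  by_cases hall : ∀ t, ∃ i ∈ m.support, i ∈ s t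
  · refine ⟨monomial m (coeff m f), ?_, key _ (by simp) ?_⟩
    · simpa [smul_monomial] using smul_mem (coeff m f) (h0 m hall)
    · exact support_monomial_subset.trans (by simpa using hm)
  · push Not at hall
    obtain ⟨t, ht⟩ := hall
    have hft : monomialSubst K (s t) (v t) f = 0 := (Ideal.mem_iInf.mp hf) t
    -- The image of the term at m must cancel, so another surviving monomial of f has the same
    -- image.
    have : ∃ m' ∈ f.support, m' ≠ m ∧ (∀ i ∈ m'.support, i ∉ s t) ∧
        Finsupp.linearCombination ℕ (v t) m = Finsupp.linearCombination ℕ (v t) m' := by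
      by_contra! hcon
      have hc : coeff (Finsupp.linearCombination ℕ (v t) m)
          (monomialSubst K (s t) (v t) f) = coeff m f := by
        conv_lhs => rw [f.as_sum, map_sum, coeff_sum]
        rw [Finset.sum_eq_single_of_mem m hm]
        · rw [monomialSubst_monomial ht, coeff_monomial, if_pos rfl]
        · intro m' hm' hne
          by_cases hm's : ∀ i ∈ m'.support, i ∉ s t
          · rw [monomialSubst_monomial hm's, coeff_monomial,
              if_neg (hcon m' hm' hne hm's).symm]
          · push Not at hm's
            obtain ⟨i, hi, his⟩ := hm's
            rw [monomialSubst_monomial_of_mem hi his, coeff_zero]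
      rw [hft, coeff_zero] at hc
      exact mem_support_iff.mp hm hc.symm
    obtain ⟨m', hm', hne, hm's, heq⟩ := this
    refine ⟨coeff m f • (monomial m 1 - monomial m' 1), smul_mem _ (h1 t m m' ht hm's heq),
      key _ ?_ ?_⟩
    · simp [coeff_monomial, hne]
    · refine (support_smul).trans ((support_sub σ _ _).trans (Finset.union_subset ?_ ?_))
      · exact support_monomial_subset.trans (by simpa using hm)
      · exact support_monomial_subset.trans (by simpa using hm')

end MonomialSubst

/-! ### The ideal J as an intersection of toric primes -/

namespace BarredMatrix

variable {r : ℕ} {c : Fin r → ℕ} {σ : Type*} (A : BarredMatrix c σ)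

theorem entry_injective (i : Fin r) : Function.Injective (A.entry i) := by
  intro j j' h
  by_contra hne
  rcases A.eq_entry_imp ⟨i, j⟩ ⟨i, j'⟩ (by simpa using hne) h with h | h <;>
    exact lt_irrefl _ h.1

theorem entry_castSucc_ne_entry_succ {i i' : Fin r} (h : i < i') (j : Fin (c i))
    (j' : Fin (c i')) : A.entry i j.castSucc ≠ A.entry i' j'.succ := by
  intro he
  rcases A.eq_entry_imp ⟨i, j.castSucc⟩ ⟨i', j'.succ⟩ (by simp [h.ne]) he with h' | h'
  · exact j'.succ_ne_zero h'.2.2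
  · exact h.asymm h'.1

theorem entry_castSucc_ne_of_lt {i i' : Fin r} (h : i < i') (j : Fin (c i))
    (j' : Fin (c i' + 1)) : A.entry i j.castSucc ≠ A.entry i' j' := by
  intro he
  rcases A.eq_entry_imp ⟨i, j.castSucc⟩ ⟨i', j'⟩ (by simp [h.ne]) he with h' | h'
  · exact j.castSucc_lt_last.ne h'.2.1
  · exact h.asymm h'.1

theorem entry_succ_ne_of_lt {i i' : Fin r} (h : i < i') (j : Fin (c i + 1))
    (j' : Fin (c i')) : A.entry i j ≠ A.entry i' j'.succ := by
  intro he
  rcases A.eq_entry_imp ⟨i, j⟩ ⟨i', j'.succ⟩ (by simp [h.ne]) he with h' | h'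
  · exact j'.succ_ne_zero h'.2.2
  · exact h.asymm h'.1

theorem finite_indices {r : ℕ} {c : Fin r → ℕ} {σ : Type*} (A : BarredMatrix c σ) : Finite σ :=
  Finite.of_surjective (fun p : Σ i : Fin r, Fin (c i + 1) => A.entry p.1 p.2) fun s => by
    obtain ⟨i, j, h⟩ := A.entry_surjective s
    exact ⟨⟨i, j⟩, h⟩

/-- The position of `s` in the block `B_t`, and `0` if `s` does not occur there. -/
noncomputable def index (t : Fin r) (s : σ) : ℕ :=
  open Classical in if h : ∃ k, A.entry t k = s then (h.choose : ℕ) else 0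

theorem index_entry (t : Fin r) (k : Fin (c t + 1)) : A.index t (A.entry t k) = k := by
  have h : ∃ k', A.entry t k' = A.entry t k := ⟨k, rfl⟩
  rw [index, dif_pos h, A.entry_injective t h.choose_spec]

theorem index_of_notMem {t : Fin r} {s : σ} (hs : s ∉ Set.range (A.entry t)) :
    A.index t s = 0 := dif_neg hs

/-- The position of `s` in the block `B_t` if this is at most `n`, otherwise `0`. -/
noncomputable def weight (t : Fin r) (n : ℕ) (s : σ) : ℕ :=
  if A.index t s ≤ n then A.index t s else 0

/-- The exponents of the monomial substitution which parametrizes the scroll on the first `n + 1`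
entries of `B_t`: the entry at position `k ≤ n` is mapped to `a * l ^ k`, where `a` is the
initial entry and `l` the new variable `X none`. -/
noncomputable def exponent (t : Fin r) (n : ℕ) (s : σ) : Option σ →₀ ℕ :=
  open Classical in
  Finsupp.single (some (if A.weight t n s = 0 then s else A.entry t 0)) 1 +
    Finsupp.single none (A.weight t n s)

theorem exponent_of_weight_eq_zero {t : Fin r} {n : ℕ} {s : σ} (h : A.weight t n s = 0) :
    A.exponent t n s = Finsupp.single (some s) 1 := by
  simp [exponent, h]

theorem exponent_entry {t : Fin r} {n : ℕ} {k : Fin (c t + 1)} (hk : (k : ℕ) ≤ n) :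
    A.exponent t n (A.entry t k) =
      Finsupp.single (some (A.entry t 0)) 1 + Finsupp.single none (k : ℕ) := by
  rw [exponent, weight, index_entry, if_pos hk]
  by_cases h : (k : ℕ) = 0
  · obtain rfl : k = 0 := Fin.ext h
    simp
  · rw [if_neg h]

theorem exponent_of_notMem {t : Fin r} {n : ℕ} {s : σ} (hs : s ∉ Set.range (A.entry t)) :
    A.exponent t n s = Finsupp.single (some s) 1 :=
  A.exponent_of_weight_eq_zero (by simp [weight, A.index_of_notMem hs])

/-- The indeterminates in the upper rows of the blocks before `B_t` and in the lower rows of the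
blocks after `B_t`. -/
def killed (t : Fin r) : Set σ :=
  {s | (∃ i < t, ∃ j : Fin (c i), A.entry i j.castSucc = s) ∨
    ∃ i > t, ∃ j : Fin (c i), A.entry i j.succ = s}

/-- A shared indeterminate is the last entry of the earlier block and the first of the later one, so
it avoids the upper row of the former and the lower row of the latter. -/
theorem entry_notMem_killed (t : Fin r) (k : Fin (c t + 1)) : A.entry t k ∉ A.killed t := by
  rintro (⟨i, hi, j, h⟩ | ⟨i, hi, j, h⟩)
  · exact A.entry_castSucc_ne_of_lt hi j k h
  · exact A.entry_succ_ne_of_lt hi k j h.symm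

variable (K : Type*) [Field K]

theorem monomialSubst_X_entry {t : Fin r} {n : ℕ} {s : Set σ} {k : Fin (c t + 1)}
    (hs : A.entry t k ∉ s) (hk : (k : ℕ) ≤ n) :
    monomialSubst K s (A.exponent t n) (X (A.entry t k)) =
      X (some (A.entry t 0)) * X none ^ (k : ℕ) := by
  rw [monomialSubst_X_of_notMem hs, A.exponent_entry hk, X, X, monomial_pow, monomial_mul]
  simp

/-- The parametrization of the component of the variety of `J` which belongs to `B_t`. -/
noncomputable def param (t : Fin r) : MvPolynomial σ K →ₐ[K] MvPolynomial (Option σ) K :=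
  monomialSubst K (A.killed t) (A.exponent t (c t))

theorem param_entry (t : Fin r) (k : Fin (c t + 1)) :
    A.param K t (X (A.entry t k)) = X (some (A.entry t 0)) * X none ^ (k : ℕ) :=
  A.monomialSubst_X_entry K (A.entry_notMem_killed t k) (Nat.lt_succ_iff.mp k.2)

theorem param_upper {i t : Fin r} (h : i < t) (j : Fin (c i)) :
    A.param K t (X (A.entry i j.castSucc)) = 0 :=
  monomialSubst_X_of_mem (.inl ⟨i, h, j, rfl⟩)

theorem param_lower {i t : Fin r} (h : t < i) (j : Fin (c i)) :
    A.param K t (X (A.entry i j.succ)) = 0 :=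
  monomialSubst_X_of_mem (.inr ⟨i, h, j, rfl⟩)

theorem minor_eq (i : Fin r) (j j' : Fin (c i)) : A.minor K i j j' =
    X (A.entry i j.castSucc) * X (A.entry i j'.succ) -
      X (A.entry i j'.castSucc) * X (A.entry i j.succ) := by
  simp [minor, block, Matrix.det_fin_two]

theorem minor_mem_ideal (i : Fin r) (j j' : Fin (c i)) : A.minor K i j j' ∈ A.ideal K := by
  rcases lt_trichotomy j j' with h | rfl | h
  · exact Ideal.subset_span (.inl ⟨i, j, j', h, rfl⟩)
  · simp [minor_eq]
  · have : A.minor K i j' j ∈ A.ideal K := Ideal.subset_span (.inl ⟨i, j', j, h, rfl⟩)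
    rw [show A.minor K i j j' = -A.minor K i j' j by simp only [minor_eq]; ring]
    exact neg_mem this

theorem mul_mem_ideal {i i' : Fin r} (h : i < i') (j : Fin (c i)) (j' : Fin (c i')) :
    X (A.entry i j.castSucc) * X (A.entry i' j'.succ) ∈ A.ideal K :=
  Ideal.subset_span (.inr ⟨i, i', j, j', h, by simp [block]⟩)

theorem ideal_le_of_forall {P : Ideal (MvPolynomial σ K)}
    (h : ∀ i, ∀ j j' : Fin (c i), A.minor K i j j' ∈ P)
    (h' : ∀ i i', i < i' → ∀ (j : Fin (c i)) (j' : Fin (c i')),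
      X (A.entry i j.castSucc) * X (A.entry i' j'.succ) ∈ P) : A.ideal K ≤ P := by
  refine Ideal.span_le.mpr ?_
  rintro f (⟨i, j, j', _, rfl⟩ | ⟨i, i', j, j', hi, rfl⟩)
  · exact h i j j'
  · simpa [block] using h' i i' hi j j'

theorem ideal_le_ker_param (t : Fin r) : A.ideal K ≤ RingHom.ker (A.param K t) := by
  refine A.ideal_le_of_forall K (fun i j j' => ?_) fun i i' hi j j' => ?_
  · rw [RingHom.mem_ker, minor_eq, map_sub, map_mul, map_mul]
    rcases lt_trichotomy i t with h | rfl | h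
    · simp [A.param_upper K h]
    · simp only [param_entry, Fin.val_castSucc, Fin.val_succ]; ring
    · simp [A.param_lower K h]
  · rw [RingHom.mem_ker, map_mul]
    rcases lt_or_ge i t with h | h
    · simp [A.param_upper K h]
    · simp [A.param_lower K (h.trans_lt hi)]

/-- Let B_t be the first block whose upper row meets m. The factor of m killed for t must then lie
in the lower row of a later block, so a product generator of J divides m. -/
theorem monomial_mem_ideal (hr : 0 < r) {m : σ →₀ ℕ}
    (hm : ∀ t, ∃ i ∈ m.support, i ∈ A.killed t) : monomial m (1 : K) ∈ A.ideal K := by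
  classical
  by_contra hmem
  have key : ∀ i i', i < i' → ∀ (j : Fin (c i)) (j' : Fin (c i')),
      A.entry i j.castSucc ∈ m.support → A.entry i' j'.succ ∈ m.support → False := by
    intro i i' hi j j' h h'
    have hne := A.entry_castSucc_ne_entry_succ hi j j'
    -- The two indeterminates differ, so exponents at least 1 suffice for their product to divide m.
    have hle : Finsupp.single (A.entry i j.castSucc) 1 + Finsupp.single (A.entry i' j'.succ) 1
        ≤ m := by
      intro s
      rw [Finsupp.mem_support_iff] at h h'
      by_cases h1 : A.entry i j.castSucc = s
      · subst h1
        simp [hne.symm]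
        omega
      · by_cases h2 : A.entry i' j'.succ = s
        · subst h2
          simp [hne]
          omega
        · simp [h1, h2]
    apply hmem
    rw [← tsub_add_cancel_of_le hle, ← one_mul (1 : K), ← monomial_mul]
    refine Ideal.mul_mem_left _ _ ?_
    have := A.mul_mem_ideal K hi j j'
    rwa [X, X, monomial_mul, one_mul] at this
  by_cases hex : ∃ i, ∃ j : Fin (c i), A.entry i j.castSucc ∈ m.support
  · obtain ⟨t, ⟨j, hj⟩, hmin⟩ := WellFounded.has_min (wellFounded_lt (α := Fin r))
      {i | ∃ j : Fin (c i), A.entry i j.castSucc ∈ m.support} hex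
    obtain ⟨s, hs, ⟨i, hi, j', rfl⟩ | ⟨i, hi, j', rfl⟩⟩ := hm t
    · exact hmin i ⟨j', hs⟩ hi
    · exact key t i hi j j' hj hs
  · push Not at hex
    -- Without upper-row factors the last block gives a contradiction, since no block follows it.
    obtain ⟨s, hs, ⟨i, hi, j', rfl⟩ | ⟨i, hi, j', rfl⟩⟩ := hm ⟨r - 1, by omega⟩
    · exact hex i j' hs
    · have : r - 1 < i.val := hi
      omega

theorem linearCombination_exponent [Fintype σ] [DecidableEq σ] (t : Fin r) (m : σ →₀ ℕ) :
    Finsupp.linearCombination ℕ (A.exponent t (c t)) m =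
      Finsupp.single (some (A.entry t 0)) (∑ k, m (A.entry t k)) +
      Finsupp.single none (∑ k, m (A.entry t k) * (k : ℕ)) +
      ∑ s ∈ (Finset.univ.image (A.entry t))ᶜ, Finsupp.single (some s) (m s) := by
  rw [Finsupp.linearCombination_apply, Finsupp.sum_fintype _ _ (by simp),
    ← Finset.sum_add_sum_compl (Finset.univ.image (A.entry t)),
    Finset.sum_image (A.entry_injective t).injOn]
  congr 1
  · rw [Finsupp.single_finsetSum, Finsupp.single_finsetSum, ← Finset.sum_add_distrib]
    refine Finset.sum_congr rfl fun k _ => ?_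
    rw [A.exponent_entry (Nat.lt_succ_iff.mp k.2)]
    simp
  · refine Finset.sum_congr rfl fun s hs => ?_
    rw [A.exponent_of_notMem (by simpa using hs)]
    simp

/-- Equal images mean equal degree and weight in the entries of B_t and equal exponents elsewhere.
Modulo J the entries of B_t satisfy the equations of the rational normal curve, so
`prod_pow_eq_prod_pow` applies. -/
theorem monomial_sub_monomial_mem_ideal (hc : ∀ i, 0 < c i) (t : Fin r) {m m' : σ →₀ ℕ}
    (h : Finsupp.linearCombination ℕ (A.exponent t (c t)) m =
      Finsupp.linearCombination ℕ (A.exponent t (c t)) m') :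
    monomial m (1 : K) - monomial m' 1 ∈ A.ideal K := by
  classical
  have := A.finite_indices
  have := Fintype.ofFinite σ
  rw [linearCombination_exponent, linearCombination_exponent] at h
  have hout : ∀ s ∈ (Finset.univ.image (A.entry t))ᶜ, m s = m' s := by
    intro s hs
    have hs' : ¬ A.entry t 0 = s := by
      rintro rfl
      simp at hs
    have := DFunLike.congr_fun h (some s)
    simpa [Finsupp.single_apply, hs', Finset.sum_ite_eq, Finsupp.finsetSum_apply,
      Finset.mem_compl.mp hs, -Finset.mem_image] using this
  have hsum : ∑ k, m (A.entry t k) = ∑ k, m' (A.entry t k) := by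
    have := DFunLike.congr_fun h (some (A.entry t 0))
    simpa [Finsupp.single_apply, Finset.sum_ite_eq, Finsupp.finsetSum_apply] using this
  have hweight : ∑ k, m (A.entry t k) * (k : ℕ) = ∑ k, m' (A.entry t k) * (k : ℕ) := by
    have := DFunLike.congr_fun h none
    simpa [Finsupp.single_apply, Finsupp.finsetSum_apply] using this
  have hprod : ∀ m : σ →₀ ℕ, Ideal.Quotient.mk (A.ideal K) (monomial m 1) =
      (∏ k, Ideal.Quotient.mk (A.ideal K) (X (A.entry t k)) ^ m (A.entry t k)) *
      ∏ s ∈ (Finset.univ.image (A.entry t))ᶜ, Ideal.Quotient.mk (A.ideal K) (X s) ^ m s := by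
    intro m
    rw [monomial_eq, map_mul, Finsupp.prod_fintype _ _ (by simp), C_1, map_one, one_mul, map_prod,
      ← Finset.prod_mul_prod_compl (Finset.univ.image (A.entry t)),
      Finset.prod_image (A.entry_injective t).injOn]
    simp only [map_pow]
  rw [← Ideal.Quotient.mk_eq_mk_iff_sub_mem, hprod, hprod]
  congr 1
  · refine prod_pow_eq_prod_pow (hc t) (fun p q => ?_) hsum hweight
    rw [← map_mul, ← map_mul, Ideal.Quotient.mk_eq_mk_iff_sub_mem]
    have := A.minor_mem_ideal K t p q
    rwa [minor_eq, mul_comm (X (A.entry t q.castSucc))] at this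
  · exact Finset.prod_congr rfl fun s hs => by rw [hout s hs]

theorem ideal_eq_iInf (hr : 0 < r) (hc : ∀ i, 0 < c i) :
    A.ideal K = ⨅ t, RingHom.ker (A.param K t) :=
  le_antisymm (le_iInf (A.ideal_le_ker_param K)) <|
    iInf_ker_monomialSubst_le (A.ideal_le_ker_param K)
      (fun _ hm => A.monomial_mem_ideal K hr hm)
      fun t _ _ _ _ h => A.monomial_sub_monomial_mem_ideal K hc t h

instance ker_param_isPrime (t : Fin r) : (RingHom.ker (A.param K t)).IsPrime :=
  RingHom.ker_isPrime _

theorem ideal_isRadical (hr : 0 < r) (hc : ∀ i, 0 < c i) : (A.ideal K).IsRadical := by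
  rw [A.ideal_eq_iInf K hr hc]
  exact Ideal.isRadical_iInf _ fun t => (A.ker_param_isPrime K t).isRadical

theorem exists_eq_ker_param (hr : 0 < r) (hc : ∀ i, 0 < c i) {P : Ideal (MvPolynomial σ K)}
    (hP : P ∈ (A.ideal K).minimalPrimes) : ∃ t, P = RingHom.ker (A.param K t) := by
  have hle := hP.1.2
  rw [A.ideal_eq_iInf K hr hc, ← Finset.inf_univ_eq_iInf, hP.1.1.inf_le'] at hle
  obtain ⟨t, -, ht⟩ := hle
  exact ⟨t, le_antisymm (hP.2 ⟨A.ker_param_isPrime K t, A.ideal_le_ker_param K t⟩ ht) ht⟩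

end BarredMatrix

/-! ### The polynomials F and G define J up to radical -/

/-- If the sums of the products `u i * v (i + d)`, `0 < d`, vanish, then so do all the products. -/
theorem mul_eq_zero_of_diagonal_sums {L : Type*} [Field L] {r : ℕ} {u v : Fin r → L}
    (h : ∀ k : Fin (r - 1), ∑ i : Fin (r - (k.val + 1)),
      u ⟨i.val, by omega⟩ * v ⟨i.val + (k.val + 1), by omega⟩ = 0)
    {i i' : Fin r} (hi : i < i') : u i * v i' = 0 := by
  suffices ∀ N, ∀ i i' : Fin r, i < i' → r - (i'.val - i.val) = N → u i * v i' = 0 from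
    this _ i i' hi rfl
  -- Descending induction on the distance d = i' − i. Multiply the relation at distance d by `u i *
  -- v i'`: every other summand then contains a product at a larger distance, and only the square of
  -- `u i * v i'` remains.
  intro N
  induction N using Nat.strong_induction_on with
  | _ N ih =>
  intro i i' hi hN
  have hi' : i.val < i'.val := hi
  have hk := h ⟨i' - i - 1, by omega⟩
  have hsingle := Finset.sum_mul (Finset.univ : Finset (Fin (r - ((i'.val - i.val - 1) + 1))))
    (fun j => u ⟨j.val, by omega⟩ * v ⟨j.val + ((i'.val - i.val - 1) + 1), by omega⟩)
    (u i * v i')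
  rw [hk, zero_mul, Finset.sum_eq_single_of_mem ⟨i.val, by omega⟩ (Finset.mem_univ _)] at hsingle
  · have h2 : (⟨i.val + ((i'.val - i.val - 1) + 1), by omega⟩ : Fin r) = i' :=
      Fin.ext (by simp only; omega)
    rw [h2] at hsingle
    exact mul_self_eq_zero.mp hsingle.symm
  · intro j _ hj
    have hj' : j.val ≠ i.val := fun h => hj (Fin.ext h)
    rcases lt_or_gt_of_ne hj' with hlt | hgt
    · have := ih (r - (i'.val - j.val)) (by omega) ⟨j.val, by omega⟩ i'
        (Fin.lt_def.mpr (by simp only; omega)) rfl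
      linear_combination (v ⟨j.val + ((i'.val - i.val - 1) + 1), by omega⟩ * u i) * this
    · have := ih (r - (j.val + ((i'.val - i.val - 1) + 1) - i.val)) (by omega) i
        ⟨j.val + ((i'.val - i.val - 1) + 1), by omega⟩
        (Fin.lt_def.mpr (by simp only; omega)) rfl
      linear_combination (u ⟨j.val, by omega⟩ * v i') * this

namespace BarredMatrix

variable {r : ℕ} {c : Fin r → ℕ} {σ : Type*} (A : BarredMatrix c σ) {K : Type*} [Field K]

/-- The images of the entries of the block `B_i`, continued by zero. -/
noncomputable def values {S : Type*} [CommRing S] (f : MvPolynomial σ K →+* S) (i : Fin r)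
    (k : ℕ) : S :=
  if h : k < c i + 1 then f (X (A.entry i ⟨k, h⟩)) else 0

theorem values_val {S : Type*} [CommRing S] (f : MvPolynomial σ K →+* S) {i : Fin r}
    (k : Fin (c i + 1)) : A.values f i k = f (X (A.entry i k)) := dif_pos k.2

theorem map_F {S : Type*} [CommRing S] (f : MvPolynomial σ K →+* S) (i : Fin r)
    (j : Fin (c i - 1)) : f (A.F K i j) = bardelliVerdi (A.values f i) j := by
  rw [F, map_sum, bardelliVerdi, ← Fin.sum_univ_eq_sum_range (fun k => (-1) ^ k *
    ((j.val + 1).choose k : S) * A.values f i (j + 2) ^ (j.val + 1 - k) * A.values f i k *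
      A.values f i (j + 1) ^ k)]
  refine Finset.sum_congr rfl fun k _ => ?_
  have h2 : A.values f i (j + 2) = _ := A.values_val f ⟨j.val + 2, by omega⟩
  have h1 : A.values f i (j + 1) = _ := A.values_val f ⟨j.val + 1, by omega⟩
  have h0 : A.values f i k = _ := A.values_val f ⟨k.val, by omega⟩
  rw [h2, h1, h0]
  simp

theorem map_G {S : Type*} [CommRing S] (f : MvPolynomial σ K →+* S) (k : Fin (r - 1)) :
    f (A.G K k) = ∑ i : Fin (r - (k.val + 1)), A.values f ⟨i.val, by omega⟩ 0 *
      A.values f ⟨i.val + (k.val + 1), by omega⟩ (c ⟨i.val + (k.val + 1), by omega⟩) := by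
  rw [G, map_sum]
  refine Finset.sum_congr rfl fun i _ => ?_
  rw [map_mul, ← values_val, ← values_val]
  rfl

/-- Before B_t the upper row is zero; B_t itself becomes a geometric progression; after B_t a block
becomes (a, 0, 0, …), a progression of ratio 0. -/
theorem F_mem_ker_param (t i : Fin r) (j : Fin (c i - 1)) :
    A.F K i j ∈ RingHom.ker (A.param K t) := by
  change (A.param K t).toRingHom (A.F K i j) = 0
  rw [map_F]
  rcases lt_trichotomy i t with h | rfl | h
  · have hz : ∀ k ≤ j.val + 1, A.values (A.param K t).toRingHom i k = 0 := by
      intro k hk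
      exact (A.values_val _ (Fin.castSucc ⟨k, by omega⟩)).trans (A.param_upper K h _)
    rw [bardelliVerdi_of_zero fun k hk => hz k (by omega), hz _ le_rfl]
    simp
  · have hz : ∀ k ≤ j.val + 2, A.values (A.param K i).toRingHom i k =
        X (some (A.entry i 0)) * X none ^ k := by
      intro k hk
      exact (A.values_val _ ⟨k, by omega⟩).trans (A.param_entry K i _)
    rw [bardelliVerdi_of_geometric fun k hk => hz k (by omega), hz _ le_rfl, hz _ (by omega)]
    ring
  · have hz : ∀ k < j.val + 2, A.values (A.param K t).toRingHom i (k + 1) = 0 := by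
      intro k hk
      exact (A.values_val _ (Fin.succ ⟨k, by omega⟩)).trans (A.param_lower K h _)
    rw [bardelliVerdi_of_geometric (l := 0)
      (a := A.values (A.param K t).toRingHom i 0), hz _ (by omega)]
    · simp
    · rintro (_ | k) hk
      · simp
      · rw [hz k (by omega)]; simp

theorem equations_mem_ideal (hr : 0 < r) (hc : ∀ i, 0 < c i)
    (p : (Σ i : Fin r, Fin (c i - 1)) ⊕ Fin (r - 1)) : A.equations K p ∈ A.ideal K := by
  rcases p with ⟨i, j⟩ | k
  · rw [A.ideal_eq_iInf K hr hc]
    exact Ideal.mem_iInf.mpr fun t => A.F_mem_ker_param t i j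
  · change A.G K k ∈ A.ideal K
    refine Ideal.sum_mem (A.ideal K) fun i _ => ?_
    have hlt : (⟨i.val, by omega⟩ : Fin r) < ⟨i.val + (k.val + 1), by omega⟩ :=
      Fin.lt_def.mpr (by simp only; omega)
    have h1 := hc ⟨i.val, by omega⟩
    have h2 := hc ⟨i.val + (k.val + 1), by omega⟩
    have := A.mul_mem_ideal K hlt ⟨0, h1⟩ ⟨c ⟨i.val + (k.val + 1), by omega⟩ - 1, by omega⟩
    have hlast : Fin.succ ⟨c ⟨i.val + (k.val + 1), by omega⟩ - 1, by omega⟩ =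
        Fin.last (c ⟨i.val + (k.val + 1), by omega⟩) := Fin.ext (Nat.sub_add_cancel h2)
    rw [hlast] at this
    exact this

theorem ideal_le_of_equations_mem (hc : ∀ i, 0 < c i) {P : Ideal (MvPolynomial σ K)}
    [P.IsPrime] (hP : ∀ p, A.equations K p ∈ P) : A.ideal K ≤ P := by
  let f : MvPolynomial σ K →+* FractionRing (MvPolynomial σ K ⧸ P) :=
    (algebraMap (MvPolynomial σ K ⧸ P) (FractionRing (MvPolynomial σ K ⧸ P))).comp
      (Ideal.Quotient.mk P)
  have hf : ∀ p, f p = 0 ↔ p ∈ P := fun p => by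
    simp [f, Ideal.Quotient.eq_zero_iff_mem]
  have hblock : ∀ i, (∀ k < c i, A.values f i k = 0) ∨
      ∃ a l, a ≠ 0 ∧ ∀ k ≤ c i, A.values f i k = a * l ^ k := by
    intro i
    have hi := hc i
    rcases eq_zero_or_geometric (y := A.values f i) (c i - 1) fun m hm => by
      rw [← A.map_F f i ⟨m, hm⟩, hf]
      exact hP (.inl ⟨i, ⟨m, hm⟩⟩) with h | ⟨a, l, ha, h⟩
    · exact .inl fun k hk => h k (by omega)
    · exact .inr ⟨a, l, ha, fun k hk => h k (by omega)⟩
  have hprod : ∀ i i', i < i' → A.values f i 0 * A.values f i' (c i') = 0 := by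
    intro i i' hi
    refine mul_eq_zero_of_diagonal_sums (u := fun i => A.values f i 0)
      (v := fun i => A.values f i (c i)) (fun k => ?_) hi
    rw [← A.map_G f k, hf]
    exact hP (.inr k)
  refine A.ideal_le_of_forall K (fun i j j' => ?_) fun i i' hi j j' => ?_
  · rw [← hf, minor_eq, map_sub, map_mul, map_mul]
    simp only [← values_val, Fin.val_castSucc, Fin.val_succ]
    rcases hblock i with h | ⟨a, l, -, h⟩
    · rw [h _ j.2, h _ j'.2]; ring
    · rw [h _ j.2.le, h _ j'.2.le, h _ (Nat.succ_le_of_lt j.2), h _ (Nat.succ_le_of_lt j'.2),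
        pow_succ, pow_succ]
      ring
  · rw [← hf, map_mul]
    simp only [← values_val, Fin.val_castSucc, Fin.val_succ]
    -- If the first entry of B_i vanishes, its progression cannot start with a ≠ 0, so its upper row
    -- is zero. If the last entry of B_i' vanishes, either the ratio is 0 or all entries are 0, so
    -- its lower row is zero.
    rcases mul_eq_zero.mp (hprod i i' hi) with h | h
    · rcases hblock i with hz | ⟨a, l, ha, hl⟩
      · rw [hz _ j.2, zero_mul]
      · rw [hl 0 (Nat.zero_le _)] at h
        simp [ha] at h
    · rcases hblock i' with hz | ⟨a, l, ha, hl⟩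
      · rcases Nat.lt_or_ge (j' + 1) (c i') with h' | h'
        · rw [hz _ h', mul_zero]
        · rw [show j'.val + 1 = c i' by omega, h, mul_zero]
      · rw [hl _ le_rfl] at h
        have hl0 : l = 0 := by
          by_contra hne
          simp [ha, hne] at h
        rw [hl _ j'.2, hl0]; simp

theorem ideal_eq_radical (hr : 0 < r) (hc : ∀ i, 0 < c i) :
    A.ideal K = (Ideal.span (Set.range (A.equations K))).radical := by
  apply le_antisymm
  · rw [Ideal.radical_eq_sInf]
    refine le_sInf fun P hP => ?_
    have := hP.2
    exact A.ideal_le_of_equations_mem hc fun p => hP.1 (Ideal.subset_span ⟨p, rfl⟩)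
  · refine (A.ideal_isRadical K hr hc).radical_le_iff.mpr (Ideal.span_le.mpr ?_)
    rintro _ ⟨p, rfl⟩
    exact A.equations_mem_ideal hr hc p

end BarredMatrix

/-! ### Lower bound for the heights by chains of primes -/

namespace BarredMatrix

variable {r : ℕ} {c : Fin r → ℕ} {σ : Type*} (A : BarredMatrix c σ) (K : Type*) [Field K]

theorem weight_succ_of_ne {t : Fin r} {n : ℕ} {s : σ} (h : A.index t s ≠ n + 1) :
    A.weight t (n + 1) s = A.weight t n s := by
  unfold weight
  split_ifs <;> omega

theorem exponent_succ_of_ne {t : Fin r} {n : ℕ} {s : σ} (h : A.index t s ≠ n + 1) :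
    A.exponent t (n + 1) s = A.exponent t n s := by
  rw [exponent, exponent, A.weight_succ_of_ne h]

theorem eq_entry_of_index_eq {t : Fin r} {s : σ} {n : ℕ} (hn : n + 1 < c t + 1)
    (h : A.index t s = n + 1) : s = A.entry t ⟨n + 1, hn⟩ := by
  by_cases hs : s ∈ Set.range (A.entry t)
  · obtain ⟨k, rfl⟩ := hs
    rw [index_entry] at h
    congr 1
    exact Fin.ext h
  · rw [A.index_of_notMem hs] at h
    omega

/-- The larger substitution factors through the smaller one by specializing the still free entry at
position n + 1 to al^(n+1). The minor X_0 X_{n+1} − X_1 X_n enters the kernel at this step; for n =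
0 it would be zero. -/
theorem ker_monomialSubst_lt_succ (t : Fin r) {n : ℕ} (h1 : 1 ≤ n) (hn : n + 1 < c t + 1) :
    RingHom.ker (monomialSubst K ∅ (A.exponent t n)) <
      RingHom.ker (monomialSubst K ∅ (A.exponent t (n + 1))) := by
  classical
  have hw : A.weight t n (A.entry t ⟨n + 1, hn⟩) = 0 := by simp [weight, index_entry]
  have hcomp : monomialSubst K ∅ (A.exponent t (n + 1)) =
      (aeval fun o => if o = some (A.entry t ⟨n + 1, hn⟩) then
        X (some (A.entry t 0)) * X none ^ (n + 1) else X o :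
        MvPolynomial (Option σ) K →ₐ[K] MvPolynomial (Option σ) K).comp
      (monomialSubst K ∅ (A.exponent t n)) := by
    refine algHom_ext fun s => ?_
    rw [AlgHom.comp_apply]
    by_cases hs : A.index t s = n + 1
    · rw [A.eq_entry_of_index_eq hn hs, A.monomialSubst_X_entry (k := ⟨n + 1, hn⟩) K (Set.notMem_empty _) le_rfl,
        monomialSubst_X_of_notMem (Set.notMem_empty _), A.exponent_of_weight_eq_zero hw]
      change _ = aeval _ (X _)
      simp
    · rw [monomialSubst_X_of_notMem (Set.notMem_empty _),
        monomialSubst_X_of_notMem (Set.notMem_empty _), A.exponent_succ_of_ne hs, aeval_monomial,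
        exponent]
      have hne : ¬ (if A.weight t n s = 0 then s else A.entry t 0) =
          A.entry t ⟨n + 1, hn⟩ := by
        split_ifs
        · rintro rfl
          exact hs (A.index_entry t _)
        · intro h
          have := A.entry_injective t h
          simp [Fin.ext_iff] at this
      rw [Finsupp.prod_add_index' (by simp) (fun _ _ _ => pow_add _ _ _), Finsupp.prod_single_index (by simp),
        Finsupp.prod_single_index (by simp)]
      simp only [Option.some.injEq, hne, reduceCtorEq, if_false, pow_one]
      rw [X, X, monomial_pow, monomial_mul]
      simp
  refine lt_of_le_of_ne ?_ fun heq => ?_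
  · intro f hf
    rw [RingHom.mem_ker] at hf ⊢
    rw [hcomp, AlgHom.comp_apply, hf, map_zero]
  · have hmem : (X (A.entry t 0) * X (A.entry t ⟨n + 1, hn⟩) -
        X (A.entry t ⟨1, by omega⟩) * X (A.entry t ⟨n, by omega⟩) : MvPolynomial σ K) ∈
        RingHom.ker (monomialSubst K ∅ (A.exponent t (n + 1))) := by
      rw [RingHom.mem_ker, map_sub, map_mul, map_mul,
        A.monomialSubst_X_entry K (Set.notMem_empty _) (by simp),
        A.monomialSubst_X_entry K (Set.notMem_empty _) (by simp),
        A.monomialSubst_X_entry K (Set.notMem_empty _) (by simp),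
        A.monomialSubst_X_entry K (Set.notMem_empty _) (by simp)]
      simp only [Fin.val_zero]
      ring
    rw [← heq, RingHom.mem_ker, map_sub, map_mul, map_mul,
        A.monomialSubst_X_entry K (Set.notMem_empty _) (by simp),
        A.monomialSubst_X_entry (k := ⟨1, _⟩) K (Set.notMem_empty _) (by simpa using h1),
        A.monomialSubst_X_entry (k := ⟨n, _⟩) K (Set.notMem_empty _) (by simp),
        monomialSubst_X_of_notMem (Set.notMem_empty _), A.exponent_of_weight_eq_zero hw] at hmem
    have hne : A.entry t 0 ≠ A.entry t ⟨n + 1, hn⟩ := fun h => by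
      simpa [Fin.ext_iff] using A.entry_injective t h
    -- Setting the free entry to 0 and all other variables to 1 sends the image of the minor to −1.
    have := congrArg (aeval fun o : Option σ => if o = some (A.entry t ⟨n + 1, hn⟩) then
      (0 : K) else 1) hmem
    change aeval _ (X _ * X _ ^ _ * X _ - _) = _ at this
    simp [hne] at this

/-- Killing one more variable outside B_t is a further specialization, and the variable itself is a
new element of the kernel. -/
theorem ker_monomialSubst_lt_insert (t : Fin r) {s : Set σ} {i : σ} (hi : i ∉ s)
    (hit : i ∉ Set.range (A.entry t)) :
    RingHom.ker (monomialSubst K s (A.exponent t (c t))) <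
      RingHom.ker (monomialSubst K (insert i s) (A.exponent t (c t))) := by
  classical
  have hcomp : monomialSubst K (insert i s) (A.exponent t (c t)) =
      (aeval fun o => if o = some i then 0 else X o :
        MvPolynomial (Option σ) K →ₐ[K] MvPolynomial (Option σ) K).comp
      (monomialSubst K s (A.exponent t (c t))) := by
    refine algHom_ext fun j => ?_
    rw [AlgHom.comp_apply]
    by_cases hj : j ∈ s
    · rw [monomialSubst_X_of_mem (Set.mem_insert_of_mem _ hj), monomialSubst_X_of_mem hj, map_zero]
    by_cases hji : j = i
    · subst hji
      rw [monomialSubst_X_of_mem (Set.mem_insert _ _), monomialSubst_X_of_notMem hj,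
        A.exponent_of_notMem hit]
      change _ = aeval _ (X _)
      simp
    · have hj' : j ∉ insert i s := by simp [hji, hj]
      by_cases hjt : j ∈ Set.range (A.entry t)
      · obtain ⟨k, rfl⟩ := hjt
        have h0 : ¬ A.entry t 0 = i := fun h => hit ⟨0, h⟩
        rw [A.monomialSubst_X_entry K hj (Nat.lt_succ_iff.mp k.2),
          A.monomialSubst_X_entry K hj' (Nat.lt_succ_iff.mp k.2)]
        simp [h0]
      · rw [monomialSubst_X_of_notMem hj, monomialSubst_X_of_notMem hj', A.exponent_of_notMem hjt]
        change _ = aeval _ (X _)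
        rw [aeval_X, if_neg (by simpa using hji)]
        rfl
  refine lt_of_le_of_ne ?_ fun heq => ?_
  · intro f hf
    rw [RingHom.mem_ker] at hf ⊢
    rw [hcomp, AlgHom.comp_apply, hf, map_zero]
  · have : X i ∈ RingHom.ker (monomialSubst K (insert i s) (A.exponent t (c t))) :=
      monomialSubst_X_of_mem (Set.mem_insert _ _)
    rw [← heq, RingHom.mem_ker, monomialSubst_X_of_notMem hi, monomial_eq_zero] at this
    exact one_ne_zero this

/-- The shift by one arises because the chain starts with the substitution on positions 0 and 1;
each further position adds one strict inclusion. -/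
theorem le_height_ker_monomialSubst_empty (t : Fin r) {n : ℕ} (hn : n + 1 ≤ c t) :
    (n : ℕ∞) ≤ (RingHom.ker (monomialSubst K ∅ (A.exponent t (n + 1)))).height := by
  induction n with
  | zero => simp
  | succ n ih =>
    have := RingHom.ker_isPrime (monomialSubst K ∅ (A.exponent t (n + 1)))
    have := RingHom.ker_isPrime (monomialSubst K ∅ (A.exponent t (n + 1 + 1)))
    rw [Nat.cast_succ]
    exact (add_le_add_left (ih (by omega)) 1).trans (Ideal.height_add_one_le_of_lt_of_isPrime
      (A.ker_monomialSubst_lt_succ K t (by omega) (by omega)))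

theorem le_height_ker_monomialSubst (t : Fin r) (ht : 0 < c t) (s : Finset σ)
    (hs : ∀ i ∈ s, i ∉ Set.range (A.entry t)) :
    ((c t - 1 + s.card : ℕ) : ℕ∞) ≤
      (RingHom.ker (monomialSubst K (s : Set σ) (A.exponent t (c t)))).height := by
  classical
  induction s using Finset.induction_on with
  | empty =>
    have := A.le_height_ker_monomialSubst_empty K t (n := c t - 1) (by omega)
    rw [Nat.sub_add_cancel ht] at this
    simpa using this
  | insert i s hi ih =>
    have := RingHom.ker_isPrime (monomialSubst K (s : Set σ) (A.exponent t (c t)))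
    have := RingHom.ker_isPrime (monomialSubst K ((insert i s : Finset σ) : Set σ)
      (A.exponent t (c t)))
    rw [Finset.card_insert_of_notMem hi, ← add_assoc, Nat.cast_succ]
    refine (add_le_add_left (ih fun j hj => hs j (Finset.mem_insert_of_mem hj)) 1).trans
      (Ideal.height_add_one_le_of_lt_of_isPrime ?_)
    rw [Finset.coe_insert]
    exact A.ker_monomialSubst_lt_insert K t (by simpa using hi) (hs i (Finset.mem_insert_self _ _))

/-- The entry at position `j` of the killed row of a block `B_i` with `i ≠ t`. -/
def killedEntry (t : Fin r) (p : Σ i : {i : Fin r // i ≠ t}, Fin (c i)) : σ :=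
  if p.1.1 < t then A.entry p.1 p.2.castSucc else A.entry p.1 p.2.succ

theorem killedEntry_mem (t : Fin r) (p : Σ i : {i : Fin r // i ≠ t}, Fin (c i)) :
    A.killedEntry t p ∈ A.killed t := by
  obtain ⟨⟨i, hi⟩, j⟩ := p
  rw [killedEntry]
  split_ifs with h
  · exact .inl ⟨i, h, j, rfl⟩
  · exact .inr ⟨i, lt_of_le_of_ne (not_lt.mp h) (Ne.symm hi), j, rfl⟩

theorem mem_range_killedEntry {t : Fin r} {s : σ} (hs : s ∈ A.killed t) :
    s ∈ Set.range (A.killedEntry t) := by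
  rcases hs with ⟨i, hi, j, rfl⟩ | ⟨i, hi, j, rfl⟩
  · exact ⟨⟨⟨i, hi.ne⟩, j⟩, if_pos hi⟩
  · exact ⟨⟨⟨i, hi.ne'⟩, j⟩, if_neg (not_lt.mpr (le_of_lt hi))⟩

/-- For an indeterminate shared by two blocks to be killed from both, the earlier block would have
to come after B_t and the later one before it. -/
theorem killedEntry_injective (t : Fin r) : Function.Injective (A.killedEntry t) := by
  have key : ∀ (p q : Σ i : {i : Fin r // i ≠ t}, Fin (c i)), p.1.1 < q.1.1 →
      A.killedEntry t p ≠ A.killedEntry t q := by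
    rintro ⟨⟨i, hi⟩, j⟩ ⟨⟨i', hi'⟩, j'⟩ (h : i < i')
    simp only [killedEntry]
    by_cases hit : i < t
    · rw [if_pos hit]
      split_ifs <;> exact A.entry_castSucc_ne_of_lt h j _
    · rw [if_neg hit, if_neg (fun h' => hit (h.trans h'))]
      exact A.entry_succ_ne_of_lt h _ j'
  intro p q h
  rcases lt_trichotomy p.1.1 q.1.1 with hlt | heq | hgt
  · exact absurd h (key p q hlt)
  · obtain ⟨⟨i, hi⟩, j⟩ := p
    obtain ⟨⟨i', hi'⟩, j'⟩ := q
    obtain rfl : i = i' := heq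
    congr 1
    simp only [killedEntry] at h
    split_ifs at h
    · exact Fin.castSucc_injective _ (A.entry_injective i h)
    · exact Fin.succ_injective _ (A.entry_injective i h)
  · exact absurd h.symm (key q p hgt)

/-- The scroll of B_t contributes c_t − 1 steps to the chain, and every other block contributes c_i
killed indeterminates. -/
theorem le_height_ker_param (hc : ∀ i, 0 < c i) (t : Fin r) :
    (((∑ i, c i) - 1 : ℕ) : ℕ∞) ≤ (RingHom.ker (A.param K t)).height := by
  classical
  have hcoe : ((Finset.univ.image (A.killedEntry t) : Finset σ) : Set σ) = A.killed t := by
    ext s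
    simp only [Finset.coe_image, Finset.coe_univ, Set.image_univ]
    refine ⟨?_, A.mem_range_killedEntry⟩
    rintro ⟨p, rfl⟩
    exact A.killedEntry_mem t p
  have hcard : (Finset.univ.image (A.killedEntry t)).card = (∑ i, c i) - c t := by
    rw [Finset.card_image_of_injective _ (A.killedEntry_injective t), Finset.card_univ,
      Fintype.card_sigma]
    simp only [Fintype.card_fin]
    rw [← Finset.sum_subtype (Finset.univ.erase t) (by simp) c, ← Finset.add_sum_erase _ _ (Finset.mem_univ t)]
    omega
  have h := A.le_height_ker_monomialSubst K t (hc t) (Finset.univ.image (A.killedEntry t)) (by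
    rintro s hs ⟨k, rfl⟩
    exact A.entry_notMem_killed t k (hcoe ▸ Finset.mem_coe.mpr hs))
  have hle : c t ≤ ∑ i, c i := Finset.single_le_sum (fun _ _ => Nat.zero_le _) (Finset.mem_univ t)
  have ht := hc t
  rw [hcard, hcoe, show c t - 1 + ((∑ i, c i) - c t) = (∑ i, c i) - 1 by omega] at h
  exact h

theorem card_equations (hr : 0 < r) (hc : ∀ i, 0 < c i) :
    Fintype.card ((Σ i : Fin r, Fin (c i - 1)) ⊕ Fin (r - 1)) = (∑ i, c i) - 1 := by
  have h : ∑ i, (c i - 1) + r = ∑ i, c i := by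
    have : ∑ i, (c i - 1 + 1) = ∑ i, c i :=
      Finset.sum_congr rfl fun i _ => Nat.sub_add_cancel (hc i)
    rw [← this, Finset.sum_add_distrib]
    simp
  simp only [Fintype.card_sum, Fintype.card_sigma, Fintype.card_fin]
  omega

end BarredMatrix

/-! ### Krull's upper bound and the conclusion -/

/-- Krull's height theorem for the radical of an ideal generated by a finite family. -/
theorem Ideal.height_le_card_of_mem_minimalPrimes_radical {R ι : Type*} [CommRing R]
    [IsNoetherianRing R] [Fintype ι] {H : ι → R} {P : Ideal R}
    (hP : P ∈ (Ideal.span (Set.range H)).radical.minimalPrimes) :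
    P.height ≤ Fintype.card ι := by
  rw [Ideal.radical_minimalPrimes] at hP
  refine (Ideal.height_le_card_of_mem_minimalPrimes_span (Set.finite_range H) hP).trans ?_
  have : (Set.range H).ncard ≤ Fintype.card ι := by
    rw [← Set.image_univ, ← Nat.card_eq_fintype_card, ← Set.ncard_univ]
    exact Set.ncard_image_le
  exact_mod_cast this

theorem BarredMatrix.height_eq_of_mem_minimalPrimes {r : ℕ} {c : Fin r → ℕ} {σ : Type*}
    (A : BarredMatrix c σ) (K : Type*) [Field K] (hr : 0 < r) (hc : ∀ i, 0 < c i)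
    {P : Ideal (MvPolynomial σ K)} (hP : P ∈ (A.ideal K).minimalPrimes) :
    P.height = ((∑ i, c i) - 1 : ℕ) := by
  have := A.finite_indices
  apply le_antisymm
  · rw [A.ideal_eq_radical hr hc] at hP
    rw [← BarredMatrix.card_equations hr hc]
    exact Ideal.height_le_card_of_mem_minimalPrimes_radical hP
  · obtain ⟨t, rfl⟩ := A.exists_eq_ker_param K hr hc hP
    exact A.le_height_ker_param K hc t

theorem theorem2 {K : Type*} [Field K] [IsAlgClosed K] {σ : Type*}
    (r : ℕ) (hr : 0 < r) (c : Fin r → ℕ) (hc : ∀ i, 0 < c i) (A : BarredMatrix c σ) :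
    (A.ideal K).IsRadical ∧
    IsOfPureHeight (A.ideal K) ((∑ i, c i) - 1) ∧
    IsSetTheoreticCompleteIntersectionOn (A.ideal K) (A.equations K) := by
  have := A.finite_indices
  have hne : A.ideal K ≠ ⊤ := fun h =>
    (A.ker_param_isPrime K ⟨0, hr⟩).ne_top (top_le_iff.mp (h ▸ A.ideal_le_ker_param K ⟨0, hr⟩))
  obtain ⟨P, hP⟩ := Ideal.nonempty_minimalPrimes hne
  refine ⟨A.ideal_isRadical K hr hc,
    ⟨hne, fun Q hQ => A.height_eq_of_mem_minimalPrimes K hr hc hQ⟩,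
    A.ideal_eq_radical hr hc, fun t H hH => ?_, ?_⟩
  · have hh := A.height_eq_of_mem_minimalPrimes K hr hc hP
    -- The prime P is also minimal over the radical of the ideal generated by H, so its height is at
    -- most t.
    rw [hH] at hP
    have hle := Ideal.height_le_card_of_mem_minimalPrimes_radical hP
    rw [hh, Fintype.card_fin] at hle
    rw [BarredMatrix.card_equations hr hc]
    exact_mod_cast hle
  · rw [BarredMatrix.card_equations hr hc, Ideal.height_eq_inf_minimalPrimes]
    apply le_antisymm
    · exact (iInf₂_le P hP).trans (A.height_eq_of_mem_minimalPrimes K hr hc hP).le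
    · exact le_iInf₂ fun Q hQ => (A.height_eq_of_mem_minimalPrimes K hr hc hQ).ge
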